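/- Let $\mathcal H$ be a real Hilbert space, $N\ge 1$, and let $F_1,\dots,F_N:\mathcal H\to\mathcal H$ be nonexpansive with fixed-point sets $X_i=\mathrm{Fix}(F_i)$ and $X^*=\bigcap_{i=1}^N X_i\neq\emptyset$. Write $d_S(y)=\inf_{s\in S}\|y-s\|$. *Network.* For $k\in\mathbb N=\{0,1,\dots\}$ let $\mathcal G_k$ be a digraph on $\{1,\dots,N\}$ with edge set $\mathcal E_k$, and let $A_k=(a_{ij,k})$ be a real $N\times N$ matrix with $a_{ij,k}>0$ if $(j,i)\in\mathcal E_k$, $a_{ij,k}=0$ otherwise, and $a_{ii,k}>0$ for all $i$. Assume that there is an integer $Q>0$ such that $\bigcup_{l=1}^Q\mathcal G_{k+l}$ is strongly connected for every $k\ge 0$, that every $A_k$ is row-stochastic, and that there is $\underline a\in(0,1)$ such that $a_{ij,k}>\underline a$ whenever $a_{ij,k}>0$. *Regularity.* Assume that each $F_i$ is boundedly linearly regular, i.e. for every bounded $\Theta\subset\mathcal H$ there is $\kappa\ge 0$ with $d_{X_i}(y)\le\kappa\|y-F_i(y)\|$ for all $y\in\Theta$; and that $\{X_i\}$ is boundedly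 linearly regular, i.e. for every bounded $\Theta\subset\mathcal H$ there is $\mu>0$ with $d_{X^*}(y)\le\mu\max_i d_{X_i}(y)$ for all $y\in\Theta$. *Iteration (D-IKM).* Let $\alpha\in(0,1/2]$, let $\alpha_{i,k}\in[\alpha,1-\alpha]$, let $\epsilon_{i,k}\in\mathcal H$ satisfy $\sum_k\|\epsilon_{i,k}\|<\infty$ for each $i$, let $x_{i,0}\in\mathcal H$ be arbitrary, and let, for all $i$ and $k$, $$x_{i,k+1}=\hat x_{i,k}+\alpha_{i,k}\bigl(F_i(\hat x_{i,k})+\epsilon_{i,k}-\hat x_{i,k}\bigr),\qquad \hat x_{i,k}=\sum_{j=1}^N a_{ij,k}x_{j,k}.$$ Then the following hold. (i) There exist *mixing constants* of the network, that is, numbers $\varpi>0$, $\xi\in(0,1)$, $\underline\pi>0$ and vectors $\pi_k\in\mathbb R^N$ ($k\ge0$) such that $\sum_j\pi_{j,k}=1$, $\pi_{j,k}\ge\underline\pi$, $\pi_k^\top=\pi_{k+1}^\top A_k$, and every entry of $A_{s-1}\cdots A_k$ satisfies $|(A_{s-1}\cdots A_k)_{ij}-\pi_{j,k}|\le\varpi\xi^{s-k}$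 for all $s\ge k$ (the product is $I$ for $s=k$). There is $\chi>0$ with $\|x_{i,k}\|\le\chi$ for all $i,k$; and for every $\chi$ there exist $\kappa_1,\dots,\kappa_N,\kappa_0\ge0$, with $\kappa_c\kappa_0>0$ where $\kappa_c:=\max_i\kappa_i$, such that for all $y$ with $\|y\|\le\chi$ $$d_{X_i}(y)\le\kappa_i\|F_i(y)-y\|\ \ (1\le i\le N),\qquad d_{X^*}(y)\le\kappa_0\max_i d_{X_i}(y).$$ (ii) For any choice of such constants, with $\|x_{i,k}\|\le\chi$ for all $i,k$, put $\alpha_c:=\sup_{i,k}\alpha_{i,k}$ and $$\gamma_2:=\frac{24N^3\varpi^2\xi^2}{(1-\xi)^2}\Bigl(2+\frac1{4N\kappa_c^2\kappa_0^2}\Bigr).$$ If $$\alpha_c<\min\Bigl\{\frac1{2\kappa_c\kappa_0}\sqrt{\frac{\underline\pi}{2N\gamma_2}},\,1-\alpha\Bigr\},$$ then there is $x^*\in X^*$ such that $x_{i,k}\to x^*$ strongly as $k\to\infty$ for all $i$. If moreover $\epsilon_{i,k}=0$ for all $i,k$ (D-KM iteration), then the convergence is at the rate $O(1/k^{\ln(1/\xi)})$: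 for every $i$, as $k\to\infty$, each of $\|x_{i,k}-x^*\|$, the squared distance $d_{X^*}(x_{i,k})^2$, and the consensus error $\|x_{i,k}-\bar x_k\|$ with $\bar x_k:=\sum_j\pi_{j,k}x_{j,k}$, is $O(1/k^{\ln(1/\xi)})$. -/

import Mathlib

noncomputable section

namespace DIKM

/-! ### Time-varying communication networks -/

/-- A digraph is strongly connected if there is a directed path between any two nodes. -/
def StronglyConnected {V : Type*} (G : Digraph V) : Prop :=
  ∀ u v : V, Relation.ReflTransGen G.Adj u v

/-- `A k` is an adjacency (weight) matrix of `G k`: the entry `(i, j)` is positive if `(j, i)` is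
an edge (agent `j` transmits to agent `i`) and zero otherwise; the self-weights are positive. -/
structure IsAdjacency {N : ℕ} (G : ℕ → Digraph (Fin N))
    (A : ℕ → Matrix (Fin N) (Fin N) ℝ) : Prop where
  pos_of_adj : ∀ k i j, (G k).Adj j i → 0 < A k i j
  zero_of_not_adj : ∀ k i j, ¬ (G k).Adj j i → A k i j = 0
  self_pos : ∀ k i, 0 < A k i i

/-- Uniform joint strong connectivity of the graphs, and the weights rule. -/
structure NetworkAssumption {N : ℕ} (G : ℕ → Digraph (Fin N))
    (A : ℕ → Matrix (Fin N) (Fin N) ℝ) : Prop where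
  jointly_connected : ∃ Q : ℕ, 0 < Q ∧
    ∀ k : ℕ, StronglyConnected (⨆ l ∈ Finset.Icc 1 Q, G (k + l))
  row_stochastic : ∀ k i, ∑ j, A k i j = 1
  weights_lower : ∃ a : ℝ, 0 < a ∧ a < 1 ∧ ∀ k i j, 0 < A k i j → a < A k i j

/-- The transition matrix `A_{s-1} ⋯ A_k` with `s = k + n` (the identity if `n = 0`). -/
def transition {N : ℕ} (A : ℕ → Matrix (Fin N) (Fin N) ℝ) (k : ℕ) :
    ℕ → Matrix (Fin N) (Fin N) ℝ
  | 0 => 1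
  | n + 1 => A (k + n) * transition A k n

/-- `ϖ`, `ξ`, the weight vectors `w k` and their lower bound `b` are mixing constants of the
network: the transition matrices `A_{s-1} ⋯ A_k` approach the rank-one matrix with rows `w k` at
the geometric rate `ϖ * ξ ^ (s - k)`. -/
structure IsMixing {N : ℕ} (A : ℕ → Matrix (Fin N) (Fin N) ℝ)
    (ϖ ξ : ℝ) (w : ℕ → Fin N → ℝ) (b : ℝ) : Prop where
  coeff_pos : 0 < ϖ
  rate_pos : 0 < ξ
  rate_lt_one : ξ < 1
  sum_one : ∀ k, ∑ j, w k j = 1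
  geometric : ∀ k n i j, |transition A k n i j - w k j| ≤ ϖ * ξ ^ n
  lower_pos : 0 < b
  lower : ∀ k j, b ≤ w k j
  invariant : ∀ k, w k = Matrix.vecMul (w (k + 1)) (A k)

/-! ### Bounded linear regularity -/

section Regularity

variable {H : Type*} [NormedAddCommGroup H]

/-- Bounded linear regularity of an operator on the whole space. -/
def BddLinearlyRegularOp (T : H → H) : Prop :=
  (Function.fixedPoints T).Nonempty ∧
  ∀ Θ : Set H, Bornology.IsBounded Θ → ∃ κ : ℝ, 0 ≤ κ ∧
    ∀ x ∈ Θ, Metric.infDist x (Function.fixedPoints T) ≤ κ * ‖x - T x‖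

/-- Bounded linear regularity of a finite family of sets with a common point. -/
def BddLinearlyRegularSets {ι : Type*} [Fintype ι] (S : ι → Set H) : Prop :=
  (⋂ i, S i).Nonempty ∧
  ∀ Θ : Set H, Bornology.IsBounded Θ → ∃ μ : ℝ, 0 < μ ∧
    ∀ x ∈ Θ, Metric.infDist x (⋂ i, S i) ≤ μ * ⨆ i, Metric.infDist x (S i)

/-- The set of common fixed points. -/
def commonFix {N : ℕ} (F : Fin N → H → H) : Set H :=
  ⋂ i, Function.fixedPoints (F i)

/-- Each operator is boundedly linearly regular, and so is the family of fixed-point sets. -/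
structure RegularityAssumption {N : ℕ} (F : Fin N → H → H) : Prop where
  operators : ∀ i, BddLinearlyRegularOp (F i)
  sets : BddLinearlyRegularSets fun i => Function.fixedPoints (F i)

/-- `κ i` and `κ₀` are linear regularity constants on the closed ball of radius `χ` at `0`. -/
structure IsRegularityConst {N : ℕ} (F : Fin N → H → H) (χ : ℝ) (κ : Fin N → ℝ) (κ₀ : ℝ) :
    Prop where
  op_nonneg : ∀ i, 0 ≤ κ i
  sets_nonneg : 0 ≤ κ₀
  op : ∀ y ∈ Metric.closedBall (0 : H) χ, ∀ i,
    Metric.infDist y (Function.fixedPoints (F i)) ≤ κ i * ‖F i y - y‖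
  sets : ∀ y ∈ Metric.closedBall (0 : H) χ,
    Metric.infDist y (commonFix F) ≤ κ₀ * ⨆ i, Metric.infDist y (Function.fixedPoints (F i))

end Regularity

/-! ### The distributed inexact Krasnosel'skii-Mann iteration -/

section Iteration

variable {H : Type*} [NormedAddCommGroup H] [Module ℝ H] {N : ℕ}

/-- The aggregate `∑ j, a_{ij,k} x_{j,k}` received by agent `i` at time `k`. -/
def aggregate (A : ℕ → Matrix (Fin N) (Fin N) ℝ) (x : Fin N → ℕ → H) (i : Fin N) (k : ℕ) : H :=
  ∑ j, A k i j • x j k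

/-- `x i k` are iterates of the D-IKM iteration with relaxation parameters `r i k` and
errors `ε i k`. -/
def IsIteration (F : Fin N → H → H) (A : ℕ → Matrix (Fin N) (Fin N) ℝ)
    (r : Fin N → ℕ → ℝ) (ε : Fin N → ℕ → H) (x : Fin N → ℕ → H) : Prop :=
  ∀ i k, x i (k + 1) = aggregate A x i k +
    r i k • (F i (aggregate A x i k) + ε i k - aggregate A x i k)

/-- The weighted average `∑ i, w_{i,k} x_{i,k}`. -/
def weightedAverage (w : ℕ → Fin N → ℝ) (x : Fin N → ℕ → H) (k : ℕ) : H :=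
  ∑ i, w k i • x i k

end Iteration

/-! ### The threshold on the relaxation parameters -/

/-- The constant `γ₂ = 24 N³ ϖ² ξ² / (1 - ξ)² * (2 + 1 / (4 N κ_c² κ₀²))`. -/
def gammaTwo (N : ℕ) (ϖ ξ κc κ₀ : ℝ) : ℝ :=
  24 * (N : ℝ) ^ 3 * ϖ ^ 2 * ξ ^ 2 / (1 - ξ) ^ 2 * (2 + 1 / (4 * (N : ℝ) * κc ^ 2 * κ₀ ^ 2))

/-- The threshold `min {1 / (2 κ_c κ₀) * √(b / (2 N γ₂)), 1 - α}`. -/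
def threshold (N : ℕ) (α ϖ ξ b κc κ₀ : ℝ) : ℝ :=
  min (1 / (2 * κc * κ₀) * √(b / (2 * (N : ℝ) * gammaTwo N ϖ ξ κc κ₀))) (1 - α)

end DIKM

end

/-! The energy `∑ i, w k i * ‖x i k - z‖ ^ 2` is a Lyapunov function for every common fixed point
`z`. The invariance `w k = w (k + 1) A k` makes averaging lower it by exactly the weighted variance
of the data each agent receives, and a relaxed nonexpansive step lowers it further by `α ^ 2` times
the squared residual (`energy_succ_le`). These two gains form the dissipation; the errors add only a
summable amount, so the dissipation is summable.

Conversely, the dissipation controls the distance to the solution set. Over a window in which every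
agent reaches every other, the square roots of the dissipations and the errors bound the
disagreement and the residuals; bounded linear regularity turns these into a distance to one common
fixed point (`exists_near_commonFix`). This distance tends to zero, and Fejér monotonicity about the
nearby points makes the iterates Cauchy.

Without errors, the infimum of the energy over common fixed points loses a fixed fraction over each
window. The decay is thus geometric, which dominates every power of `1 / k`.

Mixing constants come from the same windows: a product with all entries at least `c` contracts the
oscillation of each column by `1 - c`. -/

namespace DIKM

/-! ### Products of stochastic matrices: positivity and mixing. -/

section Network

variable {N : ℕ} {A : ℕ → Matrix (Fin N) (Fin N) ℝ}

theorem transition_add (k m n : ℕ) :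
    transition A k (m + n) = transition A (k + m) n * transition A k m := by
  induction n with
  | zero => simp [transition]
  | succ n ih =>
    change A (k + (m + n)) * transition A k (m + n) = A (k + m + n) * transition A (k + m) n * _
    rw [ih, Matrix.mul_assoc, Nat.add_assoc]

theorem transition_one (k : ℕ) : transition A k 1 = A k := by
  simp [transition]

theorem transition_nonneg (hA : ∀ k i j, 0 ≤ A k i j) (k n : ℕ) (i j : Fin N) :
    0 ≤ transition A k n i j := by
  induction n generalizing i with
  | zero =>
    change 0 ≤ (1 : Matrix (Fin N) (Fin N) ℝ) i j
    rw [Matrix.one_apply]; split_ifs <;> norm_num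
  | succ n ih =>
    change 0 ≤ (A (k + n) * transition A k n) i j
    rw [Matrix.mul_apply]
    exact Finset.sum_nonneg fun l _ => mul_nonneg (hA _ _ _) (ih l)

theorem transition_sum (hA : ∀ k i, ∑ j, A k i j = 1) (k n : ℕ) (i : Fin N) :
    ∑ j, transition A k n i j = 1 := by
  induction n generalizing i with
  | zero =>
    change ∑ j, (1 : Matrix (Fin N) (Fin N) ℝ) i j = 1
    simp [Matrix.one_apply]
  | succ n ih =>
    change ∑ j, (A (k + n) * transition A k n) i j = 1
    simp only [Matrix.mul_apply]
    rw [Finset.sum_comm]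
    simp only [← Finset.mul_sum, ih, mul_one, hA]

theorem exists_pos_of_transition_succ_pos (hA : ∀ k i j, 0 ≤ A k i j) {k n : ℕ} {i j : Fin N}
    (h : 0 < transition A k (n + 1) i j) :
    ∃ l, 0 < A (k + n) i l ∧ 0 < transition A k n l j := by
  by_contra! hc
  refine h.not_ge ?_
  change (A (k + n) * transition A k n) i j ≤ 0
  rw [Matrix.mul_apply]
  refine Finset.sum_nonpos fun l _ => ?_
  rcases (hA (k + n) i l).eq_or_lt with h0 | h0
  · simp [← h0]
  · exact mul_nonpos_of_nonneg_of_nonpos h0.le (hc l h0)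

theorem mul_transition_le (hA : ∀ k i j, 0 ≤ A k i j) (k n : ℕ) (i l j : Fin N) :
    A (k + n) i l * transition A k n l j ≤ transition A k (n + 1) i j := by
  change _ ≤ (A (k + n) * transition A k n) i j
  rw [Matrix.mul_apply]
  exact Finset.single_le_sum
    (f := fun l => A (k + n) i l * transition A k n l j)
    (fun l _ => mul_nonneg (hA _ _ _) (transition_nonneg hA _ _ _ _)) (Finset.mem_univ l)

/-- A positive entry contains a path of `n` positive weights, each above `a`. The bound is uniform
in `k`. -/
theorem pow_le_transition_of_pos (hA : ∀ k i j, 0 ≤ A k i j) {a : ℝ} (ha : 0 < a)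
    (hw : ∀ k i j, 0 < A k i j → a < A k i j) {k n : ℕ} {i j : Fin N}
    (h : 0 < transition A k n i j) : a ^ n ≤ transition A k n i j := by
  induction n generalizing i with
  | zero =>
    change 0 < (1 : Matrix (Fin N) (Fin N) ℝ) i j at h
    change _ ≤ (1 : Matrix (Fin N) (Fin N) ℝ) i j
    rw [Matrix.one_apply] at h ⊢
    split_ifs at h ⊢ <;> simp_all
  | succ n ih =>
    obtain ⟨l, hl, hlj⟩ := exists_pos_of_transition_succ_pos hA h
    calc a ^ (n + 1) = a * a ^ n := by ring
      _ ≤ A (k + n) i l * transition A k n l j :=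
        mul_le_mul (hw _ _ _ hl).le (ih hlj) (by positivity) hl.le
      _ ≤ _ := mul_transition_le hA k n i l j

theorem transition_pos_mono (hA : ∀ k i j, 0 ≤ A k i j) (hs : ∀ k i, 0 < A k i i)
    {k m n : ℕ} (hmn : m ≤ n) {i j : Fin N} (h : 0 < transition A k m i j) :
    0 < transition A k n i j := by
  induction n, hmn using Nat.le_induction with
  | base => exact h
  | succ n _ ih => exact (mul_pos (hs _ _) ih).trans_le (mul_transition_le hA k n i i j)

theorem exists_crossing_edge {V : Type*} {E : V → V → Prop} {S : Set V} {u v : V}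
    (h : Relation.ReflTransGen E u v) (hu : u ∈ S) (hv : v ∉ S) :
    ∃ p ∈ S, ∃ q ∉ S, E p q := by
  induction h with
  | refl => exact absurd hu hv
  | @tail b c _ hbc ih =>
    by_cases hb : b ∈ S
    · exact ⟨b, hb, c, hv, hbc⟩
    · exact ih hb

/-- A jointly strongly connected network with self-loops has positive transition matrices over
windows of a fixed length. -/
theorem exists_transition_pos (hN : 0 < N) {G : ℕ → Digraph (Fin N)} (hGA : IsAdjacency G A)
    (hA : ∀ k i j, 0 ≤ A k i j) (hnet : NetworkAssumption G A) :
    ∃ L : ℕ, 0 < L ∧ ∀ k i j, 0 < transition A k L i j := by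
  obtain ⟨Q, hQ, hconn⟩ := hnet.jointly_connected
  -- Each block of `Q + 1` steps brings the information of `j` to at least one new agent, until all
  -- `N` have it. The extra step is needed because the union of graphs runs over offsets `1, …, Q`,
  -- and an edge at offset `l` acts on passing to `l + 1`.
  refine ⟨N * (Q + 1), by positivity, fun k i j => ?_⟩
  set R : ℕ → Finset (Fin N) := fun n => Finset.univ.filter fun i => 0 < transition A k n i j
    with hR
  have hmem : ∀ n i, i ∈ R n ↔ 0 < transition A k n i j := by simp [hR]
  have hj : ∀ n, j ∈ R n := fun n => (hmem _ _).2 <|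
    transition_pos_mono hA hGA.self_pos (Nat.zero_le n) (by simp [transition])
  have hmono : ∀ m n, m ≤ n → R m ⊆ R n := fun m n hmn i hi =>
    (hmem _ _).2 (transition_pos_mono hA hGA.self_pos hmn ((hmem _ _).1 hi))
  have hgrow : ∀ m, (∃ v, v ∉ R m) → (R m).card < (R (m + (Q + 1))).card := by
    rintro m ⟨v, hv⟩
    obtain ⟨p, hp, q, hq, hpq⟩ :=
      exists_crossing_edge (S := {i | i ∈ R m}) (hconn (k + m) j v) (hj m) hv
    simp only [Digraph.iSup_adj] at hpq
    obtain ⟨l, hl, hadj⟩ := hpq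
    rw [Finset.mem_Icc] at hl
    have h1 : 0 < transition A k (m + l) p j :=
      transition_pos_mono hA hGA.self_pos (by omega) ((hmem _ _).1 hp)
    have h2 : 0 < transition A k (m + l + 1) q j := by
      refine (mul_pos ?_ h1).trans_le (mul_transition_le hA k (m + l) q p j)
      rw [← Nat.add_assoc]
      exact hGA.pos_of_adj _ _ _ hadj
    refine Finset.card_lt_card ((Finset.ssubset_iff_of_subset (hmono _ _ (by omega))).2
      ⟨q, (hmem _ _).2 (transition_pos_mono hA hGA.self_pos (by omega) h2), hq⟩)
  have hcard : ∀ q, min q N ≤ (R (q * (Q + 1))).card := by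
    intro q
    induction q with
    | zero => simp
    | succ q ih =>
      have hle := Finset.card_le_card (hmono (q * (Q + 1)) ((q + 1) * (Q + 1)) (by gcongr; omega))
      by_cases hall : ∃ v, v ∉ R (q * (Q + 1))
      · have := hgrow _ hall
        rw [show q * (Q + 1) + (Q + 1) = (q + 1) * (Q + 1) by ring] at this
        omega
      · push Not at hall
        rw [(Finset.eq_univ_iff_forall).2 hall] at hle
        simp only [Finset.card_univ, Fintype.card_fin] at hle
        omega
  have hfull : R (N * (Q + 1)) = Finset.univ := by
    apply Finset.eq_univ_of_card
    have := hcard N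
    have h' := Finset.card_le_univ (R (N * (Q + 1)))
    simp only [Fintype.card_fin, min_self] at *
    omega
  exact (hmem _ _).1 (hfull ▸ Finset.mem_univ i)

/-- A stochastic matrix with entries at least `c` contracts oscillation by the factor `1 - c`. -/
theorem oscillation_contract {ι : Type*} [Fintype ι] {p q v : ι → ℝ} {c B : ℝ} (hc : 0 ≤ c)
    (hp : ∀ i, c ≤ p i) (hq : ∀ i, c ≤ q i) (hp1 : ∑ i, p i = 1) (hq1 : ∑ i, q i = 1)
    (hv : ∀ i j, v i - v j ≤ B) :
    ∑ i, p i * v i - ∑ i, q i * v i ≤ (1 - c) * B := by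
  have hne : Nonempty ι := by
    by_contra h
    rw [not_nonempty_iff] at h
    simp at hp1
  obtain ⟨m, hm⟩ := Finite.exists_min v
  have hB : 0 ≤ B := by simpa using hv m m
  -- The common mass `c` cancels, and so does the shift by the minimum of `v`, since both weight
  -- vectors sum to one.
  have e1 : ∑ i, p i * v i - ∑ i, q i * v i
      = ∑ i, (p i - c) * (v i - v m) - ∑ i, (q i - c) * (v i - v m) := by
    have : ∑ i, p i * v m = ∑ i, q i * v m := by rw [← Finset.sum_mul, ← Finset.sum_mul, hp1, hq1]
    simp only [sub_mul, mul_sub, Finset.sum_sub_distrib]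
    linarith
  have e2 : ∑ i, (p i - c) * (v i - v m) ≤ ∑ i, (p i - c) * B :=
    Finset.sum_le_sum fun i _ => mul_le_mul_of_nonneg_left (hv i m) (sub_nonneg.2 (hp i))
  have e3 : 0 ≤ ∑ i, (q i - c) * (v i - v m) :=
    Finset.sum_nonneg fun i _ => mul_nonneg (sub_nonneg.2 (hq i)) (sub_nonneg.2 (hm i))
  have e4 : ∑ i, (p i - c) * B ≤ (1 - c) * B := by
    rw [← Finset.sum_mul, Finset.sum_sub_distrib, hp1]
    refine mul_le_mul_of_nonneg_right (sub_le_sub_left ?_ _) hB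
    obtain ⟨i⟩ := hne
    exact Finset.single_le_sum (f := fun _ => c) (fun _ _ => hc) (Finset.mem_univ i)
  linarith

/-- Converts decay per window of length `L` into decay per step: the rate is the `L`-th root of `ρ`,
and the factor `ρ⁻¹` pays for the incomplete last window. -/
theorem exists_pow_div_le {ρ : ℝ} (h0 : 0 < ρ) (h1 : ρ < 1) {L : ℕ} (hL : 0 < L) :
    ∃ C ξ : ℝ, 0 < C ∧ 0 < ξ ∧ ξ < 1 ∧ ∀ n : ℕ, ρ ^ (n / L) ≤ C * ξ ^ n := by
  refine ⟨ρ⁻¹, ρ ^ ((L : ℝ)⁻¹), inv_pos.2 h0, Real.rpow_pos_of_pos h0 _,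
    Real.rpow_lt_one h0.le h1 (by positivity), fun n => ?_⟩
  have hξ : (ρ ^ ((L : ℝ)⁻¹)) ^ L = ρ := Real.rpow_inv_natCast_pow h0.le hL.ne'
  have hn : n ≤ L * (n / L + 1) := by
    have := Nat.div_add_mod n L
    have := Nat.mod_lt n hL
    rw [Nat.mul_add]; omega
  rw [inv_mul_eq_div, le_div_iff₀ h0, ← pow_succ]
  calc ρ ^ (n / L + 1) = (ρ ^ ((L : ℝ)⁻¹)) ^ (L * (n / L + 1)) := by rw [pow_mul, hξ]
    _ ≤ _ := pow_le_pow_of_le_one (Real.rpow_pos_of_pos h0 _).le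
      (Real.rpow_lt_one h0.le h1 (by positivity)).le hn

/-- Later rows are convex combinations of earlier rows, so the maximum of a column cannot grow. -/
theorem transition_le_of_forall_le (hA : ∀ k i j, 0 ≤ A k i j) (hA1 : ∀ k i, ∑ j, A k i j = 1)
    {k m : ℕ} {j : Fin N} {B : ℝ} (h : ∀ i, transition A k m i j ≤ B) (n : ℕ) (i : Fin N) :
    transition A k (m + n) i j ≤ B := by
  rw [transition_add, Matrix.mul_apply]
  calc _ ≤ ∑ l, transition A (k + m) n i l * B :=
        Finset.sum_le_sum fun l _ => mul_le_mul_of_nonneg_left (h l) (transition_nonneg hA _ _ _ _)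
    _ = B := by rw [← Finset.sum_mul, transition_sum hA1, one_mul]

theorem le_transition_of_forall_le (hA : ∀ k i j, 0 ≤ A k i j) (hA1 : ∀ k i, ∑ j, A k i j = 1)
    {k m : ℕ} {j : Fin N} {B : ℝ} (h : ∀ i, B ≤ transition A k m i j) (n : ℕ) (i : Fin N) :
    B ≤ transition A k (m + n) i j := by
  rw [transition_add, Matrix.mul_apply]
  calc B = ∑ l, transition A (k + m) n i l * B := by
        rw [← Finset.sum_mul, transition_sum hA1, one_mul]
    _ ≤ _ :=
        Finset.sum_le_sum fun l _ => mul_le_mul_of_nonneg_left (h l) (transition_nonneg hA _ _ _ _)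

theorem transition_le_one (hA : ∀ k i j, 0 ≤ A k i j) (hA1 : ∀ k i, ∑ j, A k i j = 1)
    (k n : ℕ) (i j : Fin N) : transition A k n i j ≤ 1 := by
  rw [← transition_sum hA1 k n i]
  exact Finset.single_le_sum (f := fun j => transition A k n i j)
    (fun l _ => transition_nonneg hA _ _ _ _) (Finset.mem_univ j)

/-- Stochastic transition matrices that are bounded below over windows of length `L` are mixing. -/
theorem exists_isMixing_of_le_transition (hN : 0 < N) (hA : ∀ k i j, 0 ≤ A k i j)
    (hA1 : ∀ k i, ∑ j, A k i j = 1) {L : ℕ} (hL : 0 < L) {c : ℝ} (hc : 0 < c) (hc1 : c < 1)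
    (hlow : ∀ k i j, c ≤ transition A k L i j) :
    ∃ (ϖ ξ : ℝ) (w : ℕ → Fin N → ℝ) (b : ℝ), IsMixing A ϖ ξ w b := by
  have hosc : ∀ k j q i i', transition A k (L * q) i j - transition A k (L * q) i' j
      ≤ (1 - c) ^ q := by
    intro k j q
    induction q with
    | zero =>
      intro i i'
      have := transition_le_one hA hA1 k (L * 0) i j
      have := transition_nonneg hA k (L * 0) i' j
      simp only [pow_zero]; linarith
    | succ q ih =>
      intro i i'
      rw [Nat.mul_succ, transition_add, Matrix.mul_apply, Matrix.mul_apply, pow_succ']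
      exact oscillation_contract hc.le (hlow _ _) (hlow _ _) (transition_sum hA1 _ _ _)
        (transition_sum hA1 _ _ _) ih
  -- All rows at time `n` lie in the convex hull of the rows at the block time `L * m`, whose
  -- columns oscillate by at most `(1 - c) ^ m`.
  have hcomp : ∀ k j m i n i', L * m ≤ n →
      |transition A k n i j - transition A k (L * m) i' j| ≤ (1 - c) ^ m := by
    intro k j m i n i' hn
    obtain ⟨d, rfl⟩ := Nat.exists_eq_add_of_le hn
    have h1 := transition_le_of_forall_le hA hA1 (k := k) (m := L * m) (j := j)
      (B := transition A k (L * m) i' j + (1 - c) ^ m)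
      (fun l => by have := hosc k j m l i'; linarith) d i
    have h2 := le_transition_of_forall_le hA hA1 (k := k) (m := L * m) (j := j)
      (B := transition A k (L * m) i' j - (1 - c) ^ m)
      (fun l => by have := hosc k j m i' l; linarith) d i
    rw [abs_le]; constructor <;> linarith
  obtain ⟨C, ξ, hC, hξ0, hξ1, hCξ⟩ :=
    exists_pow_div_le (ρ := 1 - c) (by linarith) (by linarith) hL
  have hpair : ∀ k j n m i i', n ≤ m →
      |transition A k m i j - transition A k n i' j| ≤ 2 * C * ξ ^ n := by
    intro k j n m i i' hnm
    have hle : L * (n / L) ≤ n := Nat.mul_div_le n L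
    have h1 := hcomp k j (n / L) i m i (hle.trans hnm)
    have h2 := hcomp k j (n / L) i' n i hle
    have h3 := hCξ n
    rw [abs_le] at *
    constructor <;> linarith
  set i₀ : Fin N := ⟨0, hN⟩
  have hlim0 : Filter.Tendsto (fun n : ℕ => 2 * C * ξ ^ n) Filter.atTop (nhds 0) := by
    simpa using (tendsto_pow_atTop_nhds_zero_of_lt_one hξ0.le hξ1).const_mul (2 * C)
  -- One row suffices to define the limit, because `hpair` compares arbitrary rows.
  have hcau : ∀ k j, ∃ l, Filter.Tendsto (fun n => transition A k n i₀ j) Filter.atTop (nhds l) := by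
    intro k j
    refine cauchySeq_tendsto_of_complete (cauchySeq_of_le_tendsto_0' _ ?_ hlim0)
    intro n m hnm
    rw [dist_comm, Real.dist_eq]
    exact hpair k j n m i₀ i₀ hnm
  choose w hw using hcau
  have hgeo : ∀ k n i j, |transition A k n i j - w k j| ≤ 2 * C * ξ ^ n := by
    intro k n i j
    have : Filter.Tendsto (fun m => |transition A k n i j - transition A k m i₀ j|) Filter.atTop
        (nhds |transition A k n i j - w k j|) := ((hw k j).const_sub _).abs
    refine le_of_tendsto this ?_
    filter_upwards [Filter.eventually_ge_atTop n] with m hm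
    rw [abs_sub_comm]
    exact hpair k j n m i₀ i hm
  refine ⟨2 * C, ξ, w, c, by positivity, hξ0, hξ1, fun k => ?_, hgeo, hc, fun k j => ?_,
    fun k => ?_⟩
  · have h1 := tendsto_finsetSum Finset.univ fun j _ => hw k j
    simp only [transition_sum hA1] at h1
    exact tendsto_nhds_unique h1 tendsto_const_nhds
  · refine ge_of_tendsto (hw k j) ?_
    filter_upwards [Filter.eventually_ge_atTop L] with n hn
    obtain ⟨d, rfl⟩ := Nat.exists_eq_add_of_le hn
    exact le_transition_of_forall_le hA hA1 (fun l => hlow k l j) d i₀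
  -- Invariance is the limit of splitting off the earliest factor `A k` of the product.
  · funext j
    have h1 : Filter.Tendsto (fun n => transition A k (1 + n) i₀ j) Filter.atTop (nhds (w k j)) := by
      simpa only [add_comm 1] using (Filter.tendsto_add_atTop_iff_nat 1).2 (hw k j)
    have h2 : Filter.Tendsto (fun n => ∑ l, transition A (k + 1) n i₀ l * A k l j) Filter.atTop
        (nhds (∑ l, w (k + 1) l * A k l j)) :=
      tendsto_finsetSum _ fun l _ => (hw (k + 1) l).mul_const _
    refine tendsto_nhds_unique h1 ?_
    change Filter.Tendsto _ _ (nhds (∑ l, w (k + 1) l * A k l j))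
    simpa only [transition_add, transition_one, Matrix.mul_apply] using h2

theorem IsAdjacency.nonneg {G : ℕ → Digraph (Fin N)} (hGA : IsAdjacency G A) (k : ℕ)
    (i j : Fin N) : 0 ≤ A k i j := by
  by_cases h : (G k).Adj j i
  · exact (hGA.pos_of_adj k i j h).le
  · exact (hGA.zero_of_not_adj k i j h).ge

theorem exists_isMixing (hN : 0 < N) {G : ℕ → Digraph (Fin N)} (hGA : IsAdjacency G A)
    (hnet : NetworkAssumption G A) :
    ∃ (ϖ ξ : ℝ) (w : ℕ → Fin N → ℝ) (b : ℝ), IsMixing A ϖ ξ w b := by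
  obtain ⟨L, hL, hpos⟩ := exists_transition_pos hN hGA hGA.nonneg hnet
  obtain ⟨a, ha0, ha1, ha⟩ := hnet.weights_lower
  exact exists_isMixing_of_le_transition hN hGA.nonneg hnet.row_stochastic hL (pow_pos ha0 L)
    (pow_lt_one₀ ha0.le ha1 hL.ne')
    fun k i j => pow_le_transition_of_pos hGA.nonneg ha0 ha (hpos k i j)

end Network

end DIKM

noncomputable section

namespace DIKM

theorem mem_commonFix {H : Type*} {N : ℕ} {F : Fin N → H → H} {z : H} :
    z ∈ commonFix F ↔ ∀ i, F i z = z := by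
  simp [commonFix, Function.IsFixedPt]

/-! ### Regularity constants on balls and closedness of the solution set. -/

section Regularity

variable {H : Type*} [NormedAddCommGroup H] {N : ℕ}

theorem exists_isRegularityConst (hN : 0 < N) {F : Fin N → H → H} (hreg : RegularityAssumption F)
    (χ : ℝ) : ∃ (κ : Fin N → ℝ) (κ₀ : ℝ), IsRegularityConst F χ κ κ₀ ∧ 0 < (⨆ i, κ i) * κ₀ := by
  have hb : Bornology.IsBounded (Metric.closedBall (0 : H) χ) := Metric.isBounded_closedBall
  choose κ hκ0 hκ using fun i => (hreg.operators i).2 _ hb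
  obtain ⟨μ, hμ0, hμ⟩ := hreg.sets.2 _ hb
  -- The `+ 1` makes the supremum of the constants positive even if all `κ i` vanish.
  refine ⟨fun i => κ i + 1, μ, ⟨fun i => by linarith [hκ0 i], hμ0.le, fun y hy i => ?_, hμ⟩, ?_⟩
  · rw [norm_sub_rev]
    exact (hκ i y hy).trans (mul_le_mul_of_nonneg_right (by linarith) (norm_nonneg _))
  · refine mul_pos ?_ hμ0
    exact (by linarith [hκ0 ⟨0, hN⟩] : (0 : ℝ) < κ ⟨0, hN⟩ + 1).trans_le
      (le_ciSup (f := fun i => κ i + 1) (Set.finite_range _).bddAbove ⟨0, hN⟩)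

theorem isClosed_commonFix {F : Fin N → H → H} (hF : ∀ i y z, ‖F i y - F i z‖ ≤ ‖y - z‖) :
    IsClosed (commonFix F) := by
  refine isClosed_iInter fun i => isClosed_fixedPoints ?_
  refine (LipschitzWith.of_dist_le_mul (K := 1) fun y z => ?_).continuous
  simpa [dist_eq_norm] using hF i y z

end Regularity

/-! ### Energy inequality, boundedness, and what the dissipation controls. -/

section Hilbert

variable {H : Type*} [NormedAddCommGroup H] [InnerProductSpace ℝ H]

theorem norm_relax_sub_sq (y t z : H) (r : ℝ) :
    ‖y + r • (t - y) - z‖ ^ 2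
      = (1 - r) * ‖y - z‖ ^ 2 + r * ‖t - z‖ ^ 2 - r * (1 - r) * ‖t - y‖ ^ 2 := by
  have e1 : y + r • (t - y) - z = (y - z) + r • (t - y) := by abel
  have e2 : t - z = (y - z) + (t - y) := by abel
  rw [e1, e2, norm_add_sq_real, norm_add_sq_real, norm_smul, inner_smul_right, mul_pow,
    Real.norm_eq_abs, sq_abs]
  ring

/-- Bias-variance decomposition: the cross term vanishes because the deviations from the mean
average to zero. -/
theorem sum_mul_norm_sub_sq {ι : Type*} [Fintype ι] {a : ι → ℝ} (ha : ∑ j, a j = 1) (x : ι → H)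
    (z : H) :
    ∑ j, a j * ‖x j - z‖ ^ 2
      = ‖∑ j, a j • x j - z‖ ^ 2 + ∑ j, a j * ‖x j - ∑ l, a l • x l‖ ^ 2 := by
  set m := ∑ l, a l • x l with hm
  have h0 : ∑ j, a j * inner ℝ (x j - m) (m - z) = 0 := by
    have : ∑ j, a j • (x j - m) = 0 := by
      simp only [smul_sub, Finset.sum_sub_distrib]
      rw [← Finset.sum_smul, ha, one_smul, ← hm, sub_self]
    calc _ = inner ℝ (∑ j, a j • (x j - m)) (m - z) := by
          rw [sum_inner]; simp only [inner_smul_left]; simp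
      _ = 0 := by rw [this, inner_zero_left]
  calc _ = ∑ j, (a j * ‖x j - m‖ ^ 2 + 2 * (a j * inner ℝ (x j - m) (m - z))
          + a j * ‖m - z‖ ^ 2) := by
        refine Finset.sum_congr rfl fun j _ => ?_
        rw [show x j - z = (x j - m) + (m - z) by abel, norm_add_sq_real]
        ring
    _ = _ := by
        rw [Finset.sum_add_distrib, Finset.sum_add_distrib, ← Finset.mul_sum, h0,
          ← Finset.sum_mul, ha]
        ring

theorem norm_sum_smul_sub_le {ι : Type*} [Fintype ι] {a : ι → ℝ} (ha0 : ∀ j, 0 ≤ a j)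
    (ha : ∑ j, a j = 1) {x : ι → H} {z : H} {B : ℝ} (hB : ∀ j, ‖x j - z‖ ≤ B) :
    ‖∑ j, a j • x j - z‖ ≤ B := by
  have : ∑ j, a j • x j - z = ∑ j, a j • (x j - z) := by
    simp only [smul_sub, Finset.sum_sub_distrib]
    rw [← Finset.sum_smul, ha, one_smul]
  rw [this]
  calc _ ≤ ∑ j, ‖a j • (x j - z)‖ := norm_sum_le _ _
    _ ≤ ∑ j, a j * B := Finset.sum_le_sum fun j _ => by
        rw [norm_smul, Real.norm_of_nonneg (ha0 j)]
        exact mul_le_mul_of_nonneg_left (hB j) (ha0 j)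
    _ = B := by rw [← Finset.sum_mul, ha, one_mul]

variable {N : ℕ}

/-- The weighted squared distance of the agents to a point. -/
def energy (w : ℕ → Fin N → ℝ) (x : Fin N → ℕ → H) (z : H) (k : ℕ) : ℝ :=
  ∑ i, w k i * ‖x i k - z‖ ^ 2

/-- A lower bound for the decrease of the energy in one exact step. -/
def dissipation (F : Fin N → H → H) (A : ℕ → Matrix (Fin N) (Fin N) ℝ) (α : ℝ)
    (w : ℕ → Fin N → ℝ) (x : Fin N → ℕ → H) (k : ℕ) : ℝ :=
  ∑ i, w (k + 1) i * (∑ j, A k i j * ‖x j k - aggregate A x i k‖ ^ 2 +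
    α ^ 2 * ‖F i (aggregate A x i k) - aggregate A x i k‖ ^ 2)

variable {F : Fin N → H → H} {A : ℕ → Matrix (Fin N) (Fin N) ℝ} {α : ℝ}
  {w : ℕ → Fin N → ℝ} {r : Fin N → ℕ → ℝ} {ε : Fin N → ℕ → H} {x : Fin N → ℕ → H}

theorem norm_exact_step_sub_le (hα : 0 < α) (hF : ∀ i y z, ‖F i y - F i z‖ ≤ ‖y - z‖)
    (hr : ∀ i k, r i k ∈ Set.Icc α (1 - α)) {z : H} (hz : z ∈ commonFix F) (i : Fin N) (k : ℕ)
    (y : H) : ‖y + r i k • (F i y - y) - z‖ ^ 2 ≤ ‖y - z‖ ^ 2 - α ^ 2 * ‖F i y - y‖ ^ 2 := by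
  have h1 : ‖F i y - z‖ ^ 2 ≤ ‖y - z‖ ^ 2 := by
    have := hF i y z
    rw [mem_commonFix.1 hz i] at this
    gcongr
  obtain ⟨hl, hu⟩ := hr i k
  -- Both factors are at least `α`.
  have h2 : α ^ 2 ≤ r i k * (1 - r i k) := by nlinarith
  rw [norm_relax_sub_sq]
  nlinarith [mul_le_mul_of_nonneg_left h1 (hα.le.trans hl),
    mul_le_mul_of_nonneg_right h2 (sq_nonneg ‖F i y - y‖)]

theorem norm_exact_step_sub_le' (hα : 0 < α) (hF : ∀ i y z, ‖F i y - F i z‖ ≤ ‖y - z‖)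
    (hr : ∀ i k, r i k ∈ Set.Icc α (1 - α)) {z : H} (hz : z ∈ commonFix F) (i : Fin N) (k : ℕ)
    (y : H) : ‖y + r i k • (F i y - y) - z‖ ≤ ‖y - z‖ := by
  refine le_of_sq_le_sq ?_ (norm_nonneg _)
  have := norm_exact_step_sub_le hα hF hr hz i k y
  nlinarith [mul_nonneg (sq_nonneg α) (sq_nonneg ‖F i y - y‖)]

theorem IsIteration.succ_eq (hx : IsIteration F A r ε x) (i : Fin N) (k : ℕ) :
    x i (k + 1) = (aggregate A x i k + r i k • (F i (aggregate A x i k) - aggregate A x i k))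
      + r i k • ε i k := by
  rw [hx i k, add_sub_right_comm, smul_add, add_assoc]

theorem norm_relaxed_error_le (hα : 0 < α) (hr : ∀ i k, r i k ∈ Set.Icc α (1 - α)) (i : Fin N)
    (k : ℕ) : ‖r i k • ε i k‖ ≤ ‖ε i k‖ := by
  obtain ⟨hl, hu⟩ := hr i k
  rw [norm_smul, Real.norm_of_nonneg (by linarith)]
  exact mul_le_of_le_one_left (norm_nonneg _) (by linarith)

/-- The iterates are bounded. -/
theorem exists_norm_le (hα : 0 < α) (hF : ∀ i y z, ‖F i y - F i z‖ ≤ ‖y - z‖)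
    (hX : (commonFix F).Nonempty) (hA : ∀ k i j, 0 ≤ A k i j) (hA1 : ∀ k i, ∑ j, A k i j = 1)
    (hr : ∀ i k, r i k ∈ Set.Icc α (1 - α)) (hε : ∀ i, Summable fun k => ‖ε i k‖)
    (hx : IsIteration F A r ε x) : ∃ χ : ℝ, 0 < χ ∧ ∀ i k, ‖x i k‖ ≤ χ := by
  obtain ⟨z, hz⟩ := hX
  have hs : Summable fun k => ∑ i, ‖ε i k‖ := summable_sum fun i _ => hε i
  set B := ∑ i, ‖x i 0 - z‖
  have hB : 0 ≤ B := Finset.sum_nonneg fun _ _ => norm_nonneg _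
  have key : ∀ k i, ‖x i k - z‖ ≤ B + ∑ t ∈ Finset.range k, ∑ i, ‖ε i t‖ := by
    intro k
    induction k with
    | zero =>
      intro i
      simpa using Finset.single_le_sum (f := fun i => ‖x i 0 - z‖) (fun _ _ => norm_nonneg _)
        (Finset.mem_univ i)
    | succ k ih =>
      intro i
      rw [hx.succ_eq, Finset.sum_range_succ, add_sub_right_comm, ← add_assoc]
      refine (norm_add_le _ _).trans (add_le_add ?_ ((norm_relaxed_error_le hα hr i k).trans ?_))
      · exact (norm_exact_step_sub_le' hα hF hr hz i k _).trans
          (norm_sum_smul_sub_le (hA k i) (hA1 k i) ih)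
      · exact Finset.single_le_sum (f := fun i => ‖ε i k‖) (fun _ _ => norm_nonneg _)
          (Finset.mem_univ i)
  refine ⟨B + ∑' t, ∑ i, ‖ε i t‖ + ‖z‖ + 1, ?_, fun i k => ?_⟩
  · have : 0 ≤ ∑' t, ∑ i, ‖ε i t‖ := tsum_nonneg fun _ => Finset.sum_nonneg fun _ _ => norm_nonneg _
    positivity
  · have h1 := key k i
    have h2 : ∑ t ∈ Finset.range k, ∑ i, ‖ε i t‖ ≤ ∑' t, ∑ i, ‖ε i t‖ :=
      hs.sum_le_tsum _ fun _ _ => Finset.sum_nonneg fun _ _ => norm_nonneg _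
    have h3 := norm_sub_norm_le (x i k) z
    linarith

theorem IsMixing.pos {ϖ ξ b : ℝ} (hw : IsMixing A ϖ ξ w b) (k : ℕ) (i : Fin N) : 0 < w k i :=
  hw.lower_pos.trans_le (hw.lower k i)

theorem IsMixing.le_one {ϖ ξ b : ℝ} (hw : IsMixing A ϖ ξ w b) (k : ℕ) (i : Fin N) :
    w k i ≤ 1 := by
  rw [← hw.sum_one k]
  exact Finset.single_le_sum (fun j _ => (hw.pos k j).le) (Finset.mem_univ i)

/-- Invariance rewrites the weights at time `k` as `w (k + 1)` applied to the rows of `A k`; each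
row then splits into bias and variance. -/
theorem IsMixing.energy_eq {ϖ ξ b : ℝ} (hw : IsMixing A ϖ ξ w b)
    (hA1 : ∀ k i, ∑ j, A k i j = 1) (x : Fin N → ℕ → H) (z : H) (k : ℕ) :
    energy w x z k = ∑ i, w (k + 1) i * (‖aggregate A x i k - z‖ ^ 2 +
      ∑ j, A k i j * ‖x j k - aggregate A x i k‖ ^ 2) := by
  have : ∀ i, ‖aggregate A x i k - z‖ ^ 2 + ∑ j, A k i j * ‖x j k - aggregate A x i k‖ ^ 2
      = ∑ j, A k i j * ‖x j k - z‖ ^ 2 := fun i =>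
    (sum_mul_norm_sub_sq (hA1 k i) (fun j => x j k) z).symm
  simp only [this, energy, Finset.mul_sum]
  rw [Finset.sum_comm]
  refine Finset.sum_congr rfl fun j _ => ?_
  rw [hw.invariant k]
  change (∑ i, w (k + 1) i * A k i j) * _ = _
  rw [Finset.sum_mul]
  exact Finset.sum_congr rfl fun i _ => mul_assoc _ _ _

/-- Quasi-Fejér monotonicity of the energy. -/
theorem energy_succ_le {ϖ ξ b : ℝ} (hw : IsMixing A ϖ ξ w b) (hα : 0 < α)
    (hF : ∀ i y z, ‖F i y - F i z‖ ≤ ‖y - z‖)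
    (hA : ∀ k i j, 0 ≤ A k i j) (hA1 : ∀ k i, ∑ j, A k i j = 1)
    (hr : ∀ i k, r i k ∈ Set.Icc α (1 - α)) (hx : IsIteration F A r ε x)
    {χ R : ℝ} (hχ : ∀ i k, ‖x i k‖ ≤ χ) {z : H} (hz : z ∈ commonFix F) (hzR : ‖z‖ ≤ R) (k : ℕ) :
    energy w x z (k + 1)
      ≤ energy w x z k - dissipation F A α w x k + 2 * (χ + R) * ∑ i, ‖ε i k‖ := by
  rw [hw.energy_eq hA1 x z k, dissipation, energy, ← Finset.sum_sub_distrib, Finset.mul_sum,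
    ← Finset.sum_add_distrib]
  refine Finset.sum_le_sum fun i _ => ?_
  have hd : ∀ j k, ‖x j k - z‖ ≤ χ + R := fun j k =>
    (norm_sub_le _ _).trans (add_le_add (hχ j k) hzR)
  set y := aggregate A x i k with hy
  have hyz : ‖y - z‖ ≤ χ + R := norm_sum_smul_sub_le (hA k i) (hA1 k i) fun j => hd j k
  set p := y + r i k • (F i y - y) with hp
  have hpz : ‖p - z‖ ≤ χ + R := (norm_exact_step_sub_le' hα hF hr hz i k y).trans hyz
  have hpz2 := norm_exact_step_sub_le hα hF hr hz i k y
  have hstep : ‖x i (k + 1) - z‖ ≤ ‖p - z‖ + ‖ε i k‖ := by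
    rw [hx.succ_eq, add_sub_right_comm]
    exact (norm_add_le _ _).trans (add_le_add le_rfl (norm_relaxed_error_le hα hr i k))
  -- Factoring the difference of squares keeps the error term linear, hence summable.
  have hsq : ‖x i (k + 1) - z‖ ^ 2 ≤ ‖p - z‖ ^ 2 + 2 * (χ + R) * ‖ε i k‖ := by
    rcases le_total ‖x i (k + 1) - z‖ ‖p - z‖ with h | h
    · have : 0 ≤ (χ + R) * ‖ε i k‖ := mul_nonneg ((norm_nonneg _).trans hpz) (norm_nonneg _)
      nlinarith [norm_nonneg (x i (k + 1) - z), norm_nonneg (p - z)]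
    · have h1 : (‖x i (k + 1) - z‖ - ‖p - z‖) * (‖x i (k + 1) - z‖ + ‖p - z‖)
          ≤ ‖ε i k‖ * (2 * (χ + R)) := by
        refine mul_le_mul (by linarith) (by linarith [hd i (k + 1)]) (by positivity)
          (norm_nonneg _)
      nlinarith
  have hw1 := hw.le_one (k + 1) i
  have hw0 := (hw.pos (k + 1) i).le
  have he : w (k + 1) i * (2 * (χ + R) * ‖ε i k‖) ≤ 2 * (χ + R) * ‖ε i k‖ :=
    mul_le_of_le_one_left (mul_nonneg (by linarith [(norm_nonneg _).trans hpz]) (norm_nonneg _)) hw1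
  have hm := mul_le_mul_of_nonneg_left
    (hsq.trans (add_le_add hpz2 (le_refl (2 * (χ + R) * ‖ε i k‖)))) hw0
  linarith

theorem dissipation_nonneg {ϖ ξ b : ℝ} (hw : IsMixing A ϖ ξ w b) (hA : ∀ k i j, 0 ≤ A k i j)
    (k : ℕ) : 0 ≤ dissipation F A α w x k :=
  Finset.sum_nonneg fun _ _ => mul_nonneg (hw.pos _ _).le
    (add_nonneg (Finset.sum_nonneg fun _ _ => mul_nonneg (hA _ _ _) (sq_nonneg _)) (by positivity))

/-- Uniform lower bounds on `w` and on the positive weights let each disagreement along an edge and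
each residual be read off from the dissipation. -/
theorem exists_dissipation_bound {ϖ ξ b : ℝ} (hw : IsMixing A ϖ ξ w b) (hα : 0 < α)
    (hA : ∀ k i j, 0 ≤ A k i j) {a : ℝ} (ha : 0 < a) (haA : ∀ k i j, 0 < A k i j → a < A k i j) :
    ∃ K : ℝ, 0 ≤ K ∧ ∀ k i,
      (∀ j, 0 < A k i j → ‖x j k - aggregate A x i k‖ ≤ K * √(dissipation F A α w x k)) ∧
      ‖F i (aggregate A x i k) - aggregate A x i k‖ ≤ K * √(dissipation F A α w x k) := by
  have hb := hw.lower_pos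
  set β := min (b * a) (b * α ^ 2) with hβ
  have hβ0 : 0 < β := lt_min (by positivity) (by positivity)
  have hroot : ∀ {u d : ℝ}, 0 ≤ u → β * u ^ 2 ≤ d → u ≤ (√β)⁻¹ * √d := by
    intro u d hu h
    rw [inv_mul_eq_div, ← Real.sqrt_div' _ hβ0.le]
    exact Real.le_sqrt_of_sq_le ((le_div_iff₀ hβ0).2 (by linarith))
  refine ⟨(√β)⁻¹, by positivity, fun k i => ?_⟩
  have hnn : ∀ i, 0 ≤ ∑ j, A k i j * ‖x j k - aggregate A x i k‖ ^ 2 := fun i =>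
    Finset.sum_nonneg fun _ _ => mul_nonneg (hA _ _ _) (sq_nonneg _)
  have hi : w (k + 1) i * (∑ j, A k i j * ‖x j k - aggregate A x i k‖ ^ 2 +
      α ^ 2 * ‖F i (aggregate A x i k) - aggregate A x i k‖ ^ 2) ≤ dissipation F A α w x k :=
    Finset.single_le_sum (f := fun i => w (k + 1) i *
      (∑ j, A k i j * ‖x j k - aggregate A x i k‖ ^ 2 +
      α ^ 2 * ‖F i (aggregate A x i k) - aggregate A x i k‖ ^ 2))
      (fun i _ => mul_nonneg (hw.pos _ _).le (add_nonneg (hnn i) (by positivity)))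
      (Finset.mem_univ i)
  have hbi := (mul_le_mul_of_nonneg_right (hw.lower (k + 1) i)
    (add_nonneg (hnn i) (by positivity :
      0 ≤ α ^ 2 * ‖F i (aggregate A x i k) - aggregate A x i k‖ ^ 2))).trans hi
  constructor
  · intro j hj
    refine hroot (norm_nonneg _) ?_
    have h1 : A k i j * ‖x j k - aggregate A x i k‖ ^ 2
        ≤ ∑ j, A k i j * ‖x j k - aggregate A x i k‖ ^ 2 :=
      Finset.single_le_sum (f := fun j => A k i j * ‖x j k - aggregate A x i k‖ ^ 2)
        (fun _ _ => mul_nonneg (hA _ _ _) (sq_nonneg _)) (Finset.mem_univ j)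
    calc β * ‖x j k - aggregate A x i k‖ ^ 2 ≤ b * a * ‖x j k - aggregate A x i k‖ ^ 2 :=
          mul_le_mul_of_nonneg_right (min_le_left _ _) (sq_nonneg _)
      _ ≤ b * (A k i j * ‖x j k - aggregate A x i k‖ ^ 2) := by
          rw [mul_assoc]
          exact mul_le_mul_of_nonneg_left
            (mul_le_mul_of_nonneg_right (haA k i j hj).le (sq_nonneg _)) hb.le
      _ ≤ b * (∑ j, A k i j * ‖x j k - aggregate A x i k‖ ^ 2 +
            α ^ 2 * ‖F i (aggregate A x i k) - aggregate A x i k‖ ^ 2) :=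
          mul_le_mul_of_nonneg_left (h1.trans (le_add_of_nonneg_right (by positivity))) hb.le
      _ ≤ _ := hbi
  · refine hroot (norm_nonneg _) ?_
    calc _ ≤ b * α ^ 2 * ‖F i (aggregate A x i k) - aggregate A x i k‖ ^ 2 :=
          mul_le_mul_of_nonneg_right (min_le_right _ _) (sq_nonneg _)
      _ ≤ b * (∑ j, A k i j * ‖x j k - aggregate A x i k‖ ^ 2 +
            α ^ 2 * ‖F i (aggregate A x i k) - aggregate A x i k‖ ^ 2) := by
          rw [mul_assoc]
          exact mul_le_mul_of_nonneg_left (le_add_of_nonneg_left (hnn i)) hb.le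
      _ ≤ _ := hbi

/-- Along a positive entry of the transition matrix the iterates move by at most the accumulated
dissipation and errors. -/
theorem norm_sub_le_of_transition_pos (hα : 0 < α) (hA : ∀ k i j, 0 ≤ A k i j)
    (hr : ∀ i k, r i k ∈ Set.Icc α (1 - α)) (hx : IsIteration F A r ε x) {h : ℕ → ℝ}
    (hagg : ∀ k i j, 0 < A k i j → ‖x j k - aggregate A x i k‖ ≤ h k)
    (hres : ∀ k i, ‖F i (aggregate A x i k) - aggregate A x i k‖ ≤ h k) {k n : ℕ} {i j : Fin N}
    (hpos : 0 < transition A k n i j) :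
    ‖x i (k + n) - x j k‖ ≤ ∑ t ∈ Finset.range n, (2 * h (k + t) + ∑ i, ‖ε i (k + t)‖) := by
  induction n generalizing i with
  | zero =>
    change 0 < (1 : Matrix (Fin N) (Fin N) ℝ) i j at hpos
    rw [Matrix.one_apply] at hpos
    split_ifs at hpos with hij
    · simp [hij]
    · exact absurd hpos (lt_irrefl _)
  | succ n ih =>
    obtain ⟨l, hl, hlj⟩ := exists_pos_of_transition_succ_pos hA hpos
    rw [Finset.sum_range_succ, ← add_assoc]
    set y := aggregate A x i (k + n) with hy
    -- From neighbour `l` to the aggregate of `i`, then the relaxed step, then the error.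
    have e : x i (k + n + 1) - x j k = (x l (k + n) - x j k) +
        (-(x l (k + n) - y) + r i (k + n) • (F i y - y) + r i (k + n) • ε i (k + n)) := by
      rw [hx.succ_eq]; abel
    rw [e]
    have h1 : ‖r i (k + n) • (F i y - y)‖ ≤ h (k + n) :=
      (norm_relaxed_error_le (ε := fun i k => F i (aggregate A x i k) - aggregate A x i k)
        hα hr i (k + n)).trans (hres _ _)
    have h2 : ‖ε i (k + n)‖ ≤ ∑ i, ‖ε i (k + n)‖ :=
      Finset.single_le_sum (f := fun i => ‖ε i (k + n)‖) (fun _ _ => norm_nonneg _)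
        (Finset.mem_univ i)
    have h3 := norm_add₃_le (a := -(x l (k + n) - y)) (b := r i (k + n) • (F i y - y))
      (c := r i (k + n) • ε i (k + n))
    have h4 := norm_relaxed_error_le (ε := ε) hα hr i (k + n)
    have h5 := hagg (k + n) i l hl
    rw [norm_neg] at h3
    refine (norm_add_le _ _).trans (add_le_add (ih hlj) ?_)
    linarith

end Hilbert

end DIKM

end

noncomputable section

namespace DIKM

/-! ### Comparison of energy and distance. -/

section Energy

variable {H : Type*} [NormedAddCommGroup H] {N : ℕ} {A : ℕ → Matrix (Fin N) (Fin N) ℝ}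
  {w : ℕ → Fin N → ℝ} {x : Fin N → ℕ → H}

theorem IsMixing.mul_norm_sub_sq_le_energy {ϖ ξ b : ℝ} (hw : IsMixing A ϖ ξ w b)
    (x : Fin N → ℕ → H) (z : H) (i : Fin N) (k : ℕ) :
    b * ‖x i k - z‖ ^ 2 ≤ energy w x z k :=
  (mul_le_mul_of_nonneg_right (hw.lower k i) (sq_nonneg _)).trans
    (Finset.single_le_sum (f := fun i => w k i * ‖x i k - z‖ ^ 2)
      (fun _ _ => mul_nonneg (hw.pos _ _).le (sq_nonneg _)) (Finset.mem_univ i))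

theorem IsMixing.energy_nonneg {ϖ ξ b : ℝ} (hw : IsMixing A ϖ ξ w b)
    (x : Fin N → ℕ → H) (z : H) (k : ℕ) : 0 ≤ energy w x z k :=
  Finset.sum_nonneg fun _ _ => mul_nonneg (hw.pos _ _).le (sq_nonneg _)

theorem IsMixing.energy_le_sq {ϖ ξ b : ℝ} (hw : IsMixing A ϖ ξ w b)
    {z : H} {k : ℕ} {B : ℝ} (hB : ∀ i, ‖x i k - z‖ ≤ B) :
    energy w x z k ≤ B ^ 2 := by
  calc energy w x z k ≤ ∑ i, w k i * B ^ 2 := Finset.sum_le_sum fun i _ =>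
        mul_le_mul_of_nonneg_left (pow_le_pow_left₀ (norm_nonneg _) (hB i) 2) (hw.pos _ _).le
    _ = B ^ 2 := by rw [← Finset.sum_mul, hw.sum_one, one_mul]

end Energy

/-! ### Strong convergence and the geometric rate. -/

section Convergence

variable {H : Type*} [NormedAddCommGroup H] [InnerProductSpace ℝ H] {N : ℕ}
  {F : Fin N → H → H} {A : ℕ → Matrix (Fin N) (Fin N) ℝ} {α : ℝ}
  {w : ℕ → Fin N → ℝ} {r : Fin N → ℕ → ℝ} {ε : Fin N → ℕ → H} {x : Fin N → ℕ → H}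

/-- All agents are close to a common fixed point, up to the dissipation and the errors over a
window of fixed length. -/
theorem exists_near_commonFix (hN : 0 < N) {ϖ ξ b : ℝ} (hw : IsMixing A ϖ ξ w b) (hα : 0 < α)
    (hX : (commonFix F).Nonempty) {G : ℕ → Digraph (Fin N)} (hGA : IsAdjacency G A)
    (hnet : NetworkAssumption G A) (hr : ∀ i k, r i k ∈ Set.Icc α (1 - α))
    (hx : IsIteration F A r ε x) {χ : ℝ} (hχ : ∀ i k, ‖x i k‖ ≤ χ) {κ : Fin N → ℝ} {κ₀ : ℝ}
    (hκ : IsRegularityConst F χ κ κ₀) :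
    ∃ (T : ℕ) (C : ℝ), 0 < T ∧ 0 ≤ C ∧ ∀ k, ∀ η : ℝ, 0 < η → ∃ z ∈ commonFix F, ∀ j,
      ‖x j k - z‖ ≤ C * ∑ t ∈ Finset.range T,
        (√(dissipation F A α w x (k + t)) + ∑ i, ‖ε i (k + t)‖) + η := by
  have hA := hGA.nonneg
  have hA1 := hnet.row_stochastic
  obtain ⟨a, ha0, -, haA⟩ := hnet.weights_lower
  obtain ⟨T, hT, hpos⟩ := exists_transition_pos hN hGA hA hnet
  obtain ⟨K, hK0, hK⟩ := exists_dissipation_bound (F := F) (x := x) hw hα hA ha0 haA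
  set D := dissipation F A α w x with hD
  have : Nonempty (Fin N) := ⟨⟨0, hN⟩⟩
  set κc := ⨆ i, κ i with hκc
  have hκle : ∀ i, κ i ≤ κc := le_ciSup (Set.finite_range κ).bddAbove
  have hκc0 : 0 ≤ κc := (hκ.op_nonneg ⟨0, hN⟩).trans (hκle _)
  have hκ0 := hκ.sets_nonneg
  -- With `S` as below, `2 * S` bounds the diameter of the agents and `κ₀ * (κc + 3) * S` the
  -- distance of one agent to the solution set; `2 * K + 1` compares `S` with the sum in the claim.
  -- The slack `η` allows a near-minimizer of the distance.
  refine ⟨T, (2 + κ₀ * (κc + 3)) * (2 * K + 1), hT, by positivity, fun k η hη => ?_⟩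
  set S := ∑ t ∈ Finset.range T, (2 * (K * √(D (k + t))) + ∑ i, ‖ε i (k + t)‖) with hS
  have hS0 : 0 ≤ S := Finset.sum_nonneg fun t _ => by positivity
  have hSle : S ≤ (2 * K + 1) *
      ∑ t ∈ Finset.range T, (√(D (k + t)) + ∑ i, ‖ε i (k + t)‖) := by
    rw [Finset.mul_sum]
    refine Finset.sum_le_sum fun t _ => ?_
    have h1 : 0 ≤ √(D (k + t)) := Real.sqrt_nonneg _
    have h2 : 0 ≤ K * ∑ i, ‖ε i (k + t)‖ := by positivity
    linarith
  have hKS : K * √(D k) ≤ S := by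
    have h1 := Finset.single_le_sum
      (f := fun t => 2 * (K * √(D (k + t))) + ∑ i, ‖ε i (k + t)‖)
      (fun t _ => by positivity) (Finset.mem_range.2 hT)
    have h2 : 0 ≤ K * √(D k) := by positivity
    have h3 : 0 ≤ ∑ i, ‖ε i k‖ := by positivity
    simp only [add_zero] at h1
    linarith
  have hchain : ∀ i j, ‖x i (k + T) - x j k‖ ≤ S := fun i j =>
    norm_sub_le_of_transition_pos hα hA hr hx (h := fun k => K * √(D k))
      (fun k i j hij => (hK k i).1 j hij) (fun k i => (hK k i).2) (hpos k i j)
  have hdiam : ∀ j l, ‖x j k - x l k‖ ≤ 2 * S := by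
    intro j l
    have h1 := hchain j j
    have h2 := hchain j l
    rw [norm_sub_rev] at h1
    have h3 := norm_sub_le_norm_sub_add_norm_sub (x j k) (x j (k + T)) (x l k)
    linarith
  have hfix : ∀ j i, Metric.infDist (x j k) (Function.fixedPoints (F i)) ≤ (κc + 3) * S := by
    intro j i
    -- The positive self-weight puts agent `i` within `S` of its own aggregate; the diameter adds `2
    -- * S`.
    have h1 : ‖x j k - aggregate A x i k‖ ≤ 3 * S := by
      have h1 := (hK k i).1 i (hGA.self_pos k i)
      have h2 := hdiam j i
      have h3 := norm_sub_le_norm_sub_add_norm_sub (x j k) (x i k) (aggregate A x i k)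
      linarith
    have h2 : aggregate A x i k ∈ Metric.closedBall (0 : H) χ := by
      rw [mem_closedBall_zero_iff, ← sub_zero (aggregate A x i k)]
      exact norm_sum_smul_sub_le (hA k i) (hA1 k i) fun j => by simpa using hχ j k
    have h3 := hκ.op _ h2 i
    have h4 : κ i * ‖F i (aggregate A x i k) - aggregate A x i k‖ ≤ κc * S :=
      mul_le_mul (hκle i) ((hK k i).2.trans hKS) (norm_nonneg _) hκc0
    have h5 := Metric.infDist_le_infDist_add_dist (s := Function.fixedPoints (F i))
      (x := x j k) (y := aggregate A x i k)
    rw [dist_eq_norm] at h5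
    linarith
  set j₀ : Fin N := ⟨0, hN⟩
  have hdist : Metric.infDist (x j₀ k) (commonFix F) ≤ κ₀ * ((κc + 3) * S) :=
    (hκ.sets _ (by simpa using hχ j₀ k)).trans
      (mul_le_mul_of_nonneg_left (ciSup_le fun i => hfix j₀ i) hκ0)
  obtain ⟨z, hz, hlt⟩ := (Metric.infDist_lt_iff hX).1
    (hdist.trans_lt (lt_add_of_pos_right _ hη))
  refine ⟨z, hz, fun j => ?_⟩
  rw [dist_eq_norm] at hlt
  have h1 := hdiam j j₀
  have h2 := norm_sub_le_norm_sub_add_norm_sub (x j k) (x j₀ k) z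
  have h3 := mul_le_mul_of_nonneg_left hSle (by positivity : 0 ≤ 2 + κ₀ * (κc + 3))
  nlinarith

theorem energy_add_sum_dissipation_le {ϖ ξ b : ℝ} (hw : IsMixing A ϖ ξ w b) (hα : 0 < α)
    (hF : ∀ i y z, ‖F i y - F i z‖ ≤ ‖y - z‖)
    (hA : ∀ k i j, 0 ≤ A k i j) (hA1 : ∀ k i, ∑ j, A k i j = 1)
    (hr : ∀ i k, r i k ∈ Set.Icc α (1 - α)) (hx : IsIteration F A r ε x)
    {χ R : ℝ} (hχ : ∀ i k, ‖x i k‖ ≤ χ) {z : H} (hz : z ∈ commonFix F) (hzR : ‖z‖ ≤ R) (k n : ℕ) :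
    energy w x z (k + n) + ∑ t ∈ Finset.range n, dissipation F A α w x (k + t)
      ≤ energy w x z k + 2 * (χ + R) * ∑ t ∈ Finset.range n, ∑ i, ‖ε i (k + t)‖ := by
  induction n with
  | zero => simp
  | succ n ih =>
    have := energy_succ_le hw hα hF hA hA1 hr hx hχ hz hzR (k + n)
    rw [Finset.sum_range_succ, Finset.sum_range_succ, mul_add]
    change energy w x z (k + n + 1) + _ ≤ _
    linarith

/-- Strong convergence of the inexact iteration to a common fixed point. -/
theorem exists_tendsto_commonFix [CompleteSpace H] (hN : 0 < N) {ϖ ξ b : ℝ}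
    (hw : IsMixing A ϖ ξ w b) (hα : 0 < α) (hF : ∀ i y z, ‖F i y - F i z‖ ≤ ‖y - z‖)
    (hX : (commonFix F).Nonempty) {G : ℕ → Digraph (Fin N)} (hGA : IsAdjacency G A)
    (hnet : NetworkAssumption G A) (hr : ∀ i k, r i k ∈ Set.Icc α (1 - α))
    (hε : ∀ i, Summable fun k => ‖ε i k‖)
    (hx : IsIteration F A r ε x) {χ : ℝ} (hχ : ∀ i k, ‖x i k‖ ≤ χ) {κ : Fin N → ℝ} {κ₀ : ℝ}
    (hκ : IsRegularityConst F χ κ κ₀) :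
    ∃ xstar ∈ commonFix F, ∀ i, Filter.Tendsto (x i) Filter.atTop (nhds xstar) := by
  have hA := hGA.nonneg
  have hA1 := hnet.row_stochastic
  have hb := hw.lower_pos
  set i₀ : Fin N := ⟨0, hN⟩
  have hχ0 : 0 ≤ χ := (norm_nonneg _).trans (hχ i₀ 0)
  obtain ⟨T, C, -, hC, hnear⟩ := exists_near_commonFix hN hw hα hX hGA hnet hr hx hχ hκ
  set D := dissipation F A α w x with hD
  have hD0 : ∀ k, 0 ≤ D k := dissipation_nonneg hw hA
  set e : ℕ → ℝ := fun k => ∑ i, ‖ε i k‖ with he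
  have he0 : ∀ k, 0 ≤ e k := fun k => Finset.sum_nonneg fun _ _ => norm_nonneg _
  have hes : Summable e := summable_sum fun i _ => hε i
  have htail : ∀ k n, ∑ t ∈ Finset.range n, e (k + t) ≤ ∑' t, e (t + k) := fun k n => by
    simp only [add_comm k]
    exact ((summable_nat_add_iff k).2 hes).sum_le_tsum _ fun _ _ => he0 _
  have hDs : Summable D := by
    obtain ⟨z, hz⟩ := hX
    refine summable_of_sum_range_le hD0
      (c := energy w x z 0 + 2 * (χ + ‖z‖) * ∑' t, e (t + 0)) fun n => ?_
    have h1 := energy_add_sum_dissipation_le hw hα hF hA hA1 hr hx hχ hz le_rfl 0 n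
    have h2 := mul_le_mul_of_nonneg_left (htail 0 n) (by positivity : 0 ≤ 2 * (χ + ‖z‖))
    have h3 := hw.energy_nonneg x z (0 + n)
    simp only [zero_add] at h1 h2 h3
    simp only [he, hD] at h2 ⊢
    linarith
  have hg : Filter.Tendsto (fun k => √(D k) + e k) Filter.atTop (nhds 0) := by
    have h1 := (Real.continuous_sqrt.tendsto 0).comp hDs.tendsto_atTop_zero
    rw [Real.sqrt_zero] at h1
    simpa using h1.add hes.tendsto_atTop_zero
  set δ : ℕ → ℝ := fun k => C * ∑ t ∈ Finset.range T, (√(D (k + t)) + e (k + t))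
    + 1 / ((k : ℝ) + 1) with hδ
  have hδ0 : Filter.Tendsto δ Filter.atTop (nhds 0) := by
    have h1 : Filter.Tendsto (fun k => ∑ t ∈ Finset.range T, (√(D (k + t)) + e (k + t)))
        Filter.atTop (nhds (∑ t ∈ Finset.range T, 0)) :=
      tendsto_finsetSum _ fun t _ => (Filter.tendsto_add_atTop_iff_nat t).2 hg
    simpa [hδ] using (h1.const_mul C).add tendsto_one_div_add_atTop_nhds_zero_nat
  obtain ⟨B, hB⟩ := hδ0.bddAbove_range
  replace hB : ∀ k, δ k ≤ B := fun k => hB ⟨k, rfl⟩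
  choose z hz hzδ using fun k : ℕ => hnear k (1 / ((k : ℝ) + 1)) (by positivity)
  replace hzδ : ∀ k j, ‖x j k - z k‖ ≤ δ k := hzδ
  -- A uniform bound on the points `z k` lets one constant `M` serve the error terms of all their
  -- energies.
  have hzR : ∀ k, ‖z k‖ ≤ χ + B := fun k => by
    have h1 := hzδ k i₀
    have h2 := norm_sub_norm_le (z k) (x i₀ k)
    rw [norm_sub_rev] at h2
    linarith [hB k, hχ i₀ k]
  have hB0 : 0 ≤ B := ((norm_nonneg _).trans (hzδ 0 i₀)).trans (hB 0)
  set M := 2 * (χ + (χ + B)) with hM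
  have hM0 : 0 ≤ M := by positivity
  -- The energy about `z k` is at most `δ k ^ 2` at time `k` and later grows by at most `M` times
  -- the error tail; dividing by `b` bounds each agent.
  set ρ : ℕ → ℝ := fun k => √((δ k ^ 2 + M * ∑' t, e (t + k)) / b) with hρ
  have hρ0 : Filter.Tendsto ρ Filter.atTop (nhds 0) := by
    have h1 := ((hδ0.pow 2).add ((tendsto_sum_nat_add e).const_mul M)).div_const b
    simpa [hρ, Function.comp_def] using (Real.continuous_sqrt.tendsto _).comp h1
  have hclose : ∀ k m i, k ≤ m → ‖x i m - z k‖ ≤ ρ k := by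
    intro k m i hkm
    obtain ⟨n, rfl⟩ := Nat.exists_eq_add_of_le hkm
    have h1 := energy_add_sum_dissipation_le hw hα hF hA hA1 hr hx hχ (hz k) (hzR k) k n
    have h2 := hw.mul_norm_sub_sq_le_energy x (z k) i (k + n)
    have h3 := hw.energy_le_sq (hzδ k)
    have h4 := mul_le_mul_of_nonneg_left (htail k n) hM0
    have h5 : 0 ≤ ∑ t ∈ Finset.range n, D (k + t) := Finset.sum_nonneg fun _ _ => hD0 _
    refine Real.le_sqrt_of_sq_le ((le_div_iff₀ hb).2 ?_)
    simp only [he, hD, hM] at h4 h5 ⊢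
    linarith
  have hcau : CauchySeq (x i₀) := by
    refine cauchySeq_of_le_tendsto_0 (fun k => 2 * ρ k) (fun m n k hm hn => ?_)
      (by simpa using hρ0.const_mul 2)
    have h1 := hclose k m i₀ hm
    have h2 := hclose k n i₀ hn
    have h3 := norm_sub_le_norm_sub_add_norm_sub (x i₀ m) (z k) (x i₀ n)
    rw [norm_sub_rev (z k)] at h3
    rw [dist_eq_norm]
    linarith
  obtain ⟨xs, hxs⟩ := cauchySeq_tendsto_of_complete hcau
  have hdiff : ∀ i, Filter.Tendsto (fun k => x i k - z k) Filter.atTop (nhds 0) := fun i =>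
    squeeze_zero_norm (fun k => hclose k k i le_rfl) hρ0
  have hzs : Filter.Tendsto z Filter.atTop (nhds xs) := by
    simpa using hxs.sub (hdiff i₀)
  refine ⟨xs, (isClosed_commonFix hF).mem_of_tendsto hzs (Filter.Eventually.of_forall hz),
    fun i => ?_⟩
  simpa using (hdiff i).add hzs

theorem le_mul_pow_div_of_antitone {W : ℕ → ℝ} (hW : Antitone W) {ρ : ℝ} (hρ : 0 ≤ ρ) {T : ℕ}
    (hstep : ∀ k, W (k + T) ≤ ρ * W k) (k : ℕ) : W k ≤ ρ ^ (k / T) * W 0 := by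
  have h : ∀ q, W (T * q) ≤ ρ ^ q * W 0 := by
    intro q
    induction q with
    | zero => simp
    | succ q ih =>
      rw [Nat.mul_succ, pow_succ', mul_assoc]
      exact (hstep _).trans (mul_le_mul_of_nonneg_left ih hρ)
  exact (hW (Nat.mul_div_le k T)).trans (h _)

/-- Without errors the convergence is geometric. -/
theorem exists_norm_sub_sq_le_geometric (hN : 0 < N) {ϖ ξ b : ℝ}
    (hw : IsMixing A ϖ ξ w b) (hα : 0 < α) (hF : ∀ i y z, ‖F i y - F i z‖ ≤ ‖y - z‖)
    (hX : (commonFix F).Nonempty) {G : ℕ → Digraph (Fin N)} (hGA : IsAdjacency G A)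
    (hnet : NetworkAssumption G A) (hr : ∀ i k, r i k ∈ Set.Icc α (1 - α))
    (hε : ∀ i k, ε i k = 0)
    (hx : IsIteration F A r ε x) {χ : ℝ} (hχ : ∀ i k, ‖x i k‖ ≤ χ) {κ : Fin N → ℝ} {κ₀ : ℝ}
    (hκ : IsRegularityConst F χ κ κ₀) {xstar : H}
    (hlim : ∀ i, Filter.Tendsto (x i) Filter.atTop (nhds xstar)) :
    ∃ C q : ℝ, 0 ≤ C ∧ 0 < q ∧ q < 1 ∧ ∀ i k, ‖x i k - xstar‖ ^ 2 ≤ C * q ^ k := by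
  have hA := hGA.nonneg
  have hA1 := hnet.row_stochastic
  have hb := hw.lower_pos
  obtain ⟨T, C, hT, hC, hnear⟩ := exists_near_commonFix hN hw hα hX hGA hnet hr hx hχ hκ
  have hfejer : ∀ z ∈ commonFix F, ∀ k n,
      energy w x z (k + n) + ∑ t ∈ Finset.range n, dissipation F A α w x (k + t)
        ≤ energy w x z k := fun z hz k n => by
    simpa [hε] using energy_add_sum_dissipation_le hw hα hF hA hA1 hr hx hχ hz le_rfl k n
  simp only [hε, norm_zero, Finset.sum_const_zero, add_zero] at hnear
  set D := dissipation F A α w x with hD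
  have hD0 : ∀ k, 0 ≤ D k := dissipation_nonneg hw hA
  have hmono : ∀ z ∈ commonFix F, ∀ k n, k ≤ n → energy w x z n ≤ energy w x z k := by
    intro z hz k n hkn
    obtain ⟨d, rfl⟩ := Nat.exists_eq_add_of_le hkn
    have h1 := hfejer z hz k d
    have h2 : 0 ≤ ∑ t ∈ Finset.range d, D (k + t) := Finset.sum_nonneg fun _ _ => hD0 _
    linarith
  have : Nonempty (commonFix F) := hX.to_subtype
  -- The infimum makes the decrease independent of the nearby common fixed point, which changes with
  -- `k`.
  set W : ℕ → ℝ := fun k => ⨅ z : commonFix F, energy w x (z : H) k with hWdef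
  have hbdd : ∀ k, BddBelow (Set.range fun z : commonFix F => energy w x (z : H) k) := fun k =>
    ⟨0, by rintro _ ⟨z, rfl⟩; exact hw.energy_nonneg x z k⟩
  have hWle : ∀ k, ∀ z ∈ commonFix F, W k ≤ energy w x z k := fun k z hz =>
    ciInf_le (hbdd k) (⟨z, hz⟩ : commonFix F)
  have hW0 : ∀ k, 0 ≤ W k := fun k => le_ciInf fun z => hw.energy_nonneg x z k
  have hWanti : Antitone W := fun k n hkn =>
    le_ciInf fun z => (hWle n z z.2).trans (hmono z z.2 k n hkn)
  have hWσ : ∀ k, W k ≤ (C * T) ^ 2 * ∑ t ∈ Finset.range T, D (k + t) := by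
    intro k
    set σ := ∑ t ∈ Finset.range T, D (k + t) with hσ
    have hσ0 : 0 ≤ σ := Finset.sum_nonneg fun _ _ => hD0 _
    have hsum : ∑ t ∈ Finset.range T, √(D (k + t)) ≤ T * √σ := by
      have : ∀ t ∈ Finset.range T, √(D (k + t)) ≤ √σ := fun t ht => Real.sqrt_le_sqrt <|
        Finset.single_le_sum (f := fun t => D (k + t)) (fun _ _ => hD0 _) ht
      simpa using Finset.sum_le_sum this
    have hη : ∀ η : ℝ, 0 < η → √(W k) ≤ C * T * √σ + η := by
      intro η hη
      obtain ⟨z, hz, hzx⟩ := hnear k η hη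
      refine Real.sqrt_le_iff.2 ⟨by positivity, (hWle k z hz).trans (hw.energy_le_sq fun i => ?_)⟩
      have := mul_le_mul_of_nonneg_left hsum hC
      linarith [hzx i]
    calc W k ≤ (C * T * √σ) ^ 2 :=
          (Real.sqrt_le_left (by positivity)).1 (le_of_forall_pos_le_add hη)
      _ = _ := by rw [mul_pow, Real.sq_sqrt hσ0]
  -- The summand `2` keeps the contraction factor `1 - c⁻¹` at least `1 / 2`, hence positive.
  set c := (C * T) ^ 2 + 2 with hc
  have hc2 : 2 ≤ c := by have := sq_nonneg (C * T); linarith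
  have hstep : ∀ k, W (k + T) ≤ (1 - c⁻¹) * W k := by
    intro k
    set σ := ∑ t ∈ Finset.range T, D (k + t) with hσ
    have hσ0 : 0 ≤ σ := Finset.sum_nonneg fun _ _ => hD0 _
    have h1 : W (k + T) + σ ≤ W k := le_ciInf fun z => by
      have h1 := hfejer z z.2 k T
      have h2 := hWle (k + T) z z.2
      linarith
    have h2 : c⁻¹ * W k ≤ σ := by
      rw [inv_mul_le_iff₀ (by linarith)]
      have := hWσ k
      simp only [hc]; nlinarith
    linarith
  have hci : c⁻¹ ≤ 1 / 2 := by
    rw [one_div]; exact inv_anti₀ (by norm_num) hc2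
  have hci0 : 0 < c⁻¹ := by positivity
  obtain ⟨C', q, hC', hq0, hq1, hCq⟩ :=
    exists_pow_div_le (ρ := 1 - c⁻¹) (by linarith) (by linarith) hT
  have hWq : ∀ k, W k ≤ C' * q ^ k * W 0 := fun k =>
    (le_mul_pow_div_of_antitone hWanti (by linarith) hstep k).trans
      (mul_le_mul_of_nonneg_right (hCq k) (hW0 0))
  -- By monotonicity the energy about `z` at time `k` also bounds `b * ‖xstar - z‖ ^ 2` in the
  -- limit; the triangle inequality through `z` gives `2 + 2 = 4`.
  have hxW : ∀ i k, b * ‖x i k - xstar‖ ^ 2 ≤ 4 * W k := by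
    intro i k
    suffices h : b * ‖x i k - xstar‖ ^ 2 / 4 ≤ W k by linarith
    refine le_ciInf fun z => ?_
    have h1 : b * ‖xstar - z‖ ^ 2 ≤ energy w x z k := by
      refine le_of_tendsto ((((hlim i).sub_const (z : H)).norm.pow 2).const_mul b) ?_
      filter_upwards [Filter.eventually_ge_atTop k] with m hm
      exact (hw.mul_norm_sub_sq_le_energy x z i m).trans (hmono z z.2 k m hm)
    have h2 := hw.mul_norm_sub_sq_le_energy x (z : H) i k
    have h3 : ‖x i k - xstar‖ ^ 2 ≤ 2 * ‖x i k - z‖ ^ 2 + 2 * ‖xstar - z‖ ^ 2 := by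
      have h4 := norm_sub_le_norm_sub_add_norm_sub (x i k) (z : H) xstar
      rw [norm_sub_rev (z : H)] at h4
      nlinarith [norm_nonneg (x i k - xstar), sq_nonneg (‖x i k - z‖ - ‖xstar - z‖)]
    nlinarith
  refine ⟨4 * C' * W 0 / b, q, by have := hW0 0; positivity, hq0, hq1, fun i k => ?_⟩
  rw [div_mul_eq_mul_div, le_div_iff₀ hb]
  have := hxW i k
  have := hWq k
  linarith

/-- Exponential decay beats every power, so the exponent `p` is arbitrary. -/
theorem isBigO_pow_rpow {q : ℝ} (hq0 : 0 < q) (hq1 : q < 1) (p : ℝ) :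
    (fun k : ℕ => q ^ k) =O[Filter.atTop] (fun k : ℕ => 1 / (k : ℝ) ^ p) := by
  have hlog : 0 < -Real.log q := neg_pos.2 (Real.log_neg hq0 hq1)
  have h := ((isLittleO_exp_neg_mul_rpow_atTop hlog (-p)).comp_tendsto
    tendsto_natCast_atTop_atTop).isBigO
  refine h.congr (fun k => ?_) fun k => ?_
  · simp only [Function.comp, neg_neg]
    rw [mul_comm, Real.exp_nat_mul, Real.exp_log hq0]
  · simp [Real.rpow_neg]

end Convergence

end DIKM

end

/-! ### Existence of the constants, convergence and rate. -/

theorem theorem2 {H : Type*} [NormedAddCommGroup H] [InnerProductSpace ℝ H] [CompleteSpace H]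
    (N : ℕ) (hN : 0 < N)
    (F : Fin N → H → H) (hF : ∀ i y z, ‖F i y - F i z‖ ≤ ‖y - z‖)
    (hX : (DIKM.commonFix F).Nonempty)
    (G : ℕ → Digraph (Fin N)) (A : ℕ → Matrix (Fin N) (Fin N) ℝ)
    (hGA : DIKM.IsAdjacency G A) (hnet : DIKM.NetworkAssumption G A)
    (hreg : DIKM.RegularityAssumption F)
    (α : ℝ) (hα₀ : 0 < α) (hα₁ : α ≤ 1 / 2)
    (r : Fin N → ℕ → ℝ) (hr : ∀ i k, r i k ∈ Set.Icc α (1 - α))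
    (ε : Fin N → ℕ → H) (hε : ∀ i, Summable fun k => ‖ε i k‖)
    (x : Fin N → ℕ → H) (hx : DIKM.IsIteration F A r ε x) :
    -- the constants entering the threshold exist
    (∃ (ϖ ξ : ℝ) (w : ℕ → Fin N → ℝ) (b : ℝ), DIKM.IsMixing A ϖ ξ w b) ∧
    (∃ χ : ℝ, 0 < χ ∧ ∀ i k, ‖x i k‖ ≤ χ) ∧
    (∀ χ : ℝ, ∃ (κ : Fin N → ℝ) (κ₀ : ℝ),
      DIKM.IsRegularityConst F χ κ κ₀ ∧ 0 < (⨆ i, κ i) * κ₀) ∧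
    -- for any such constants, the threshold condition gives convergence and the rate
    (∀ (ϖ ξ : ℝ) (w : ℕ → Fin N → ℝ) (b : ℝ), DIKM.IsMixing A ϖ ξ w b →
      ∀ χ : ℝ, 0 < χ → (∀ i k, ‖x i k‖ ≤ χ) →
      ∀ (κ : Fin N → ℝ) (κ₀ : ℝ), DIKM.IsRegularityConst F χ κ κ₀ → 0 < (⨆ i, κ i) * κ₀ →
      (⨆ p : Fin N × ℕ, r p.1 p.2) < DIKM.threshold N α ϖ ξ b (⨆ i, κ i) κ₀ →
      ∃ xstar ∈ DIKM.commonFix F,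
        (∀ i, Filter.Tendsto (x i) Filter.atTop (nhds xstar)) ∧
        ((∀ i k, ε i k = 0) → ∀ i,
          (fun k => ‖x i k - xstar‖) =O[Filter.atTop]
            (fun k : ℕ => 1 / (k : ℝ) ^ Real.log (1 / ξ)) ∧
          (fun k => Metric.infDist (x i k) (DIKM.commonFix F) ^ 2) =O[Filter.atTop]
            (fun k : ℕ => 1 / (k : ℝ) ^ Real.log (1 / ξ)) ∧
          (fun k => ‖x i k - DIKM.weightedAverage w x k‖) =O[Filter.atTop]
            (fun k : ℕ => 1 / (k : ℝ) ^ Real.log (1 / ξ)))) := by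
  refine ⟨DIKM.exists_isMixing hN hGA hnet,
    DIKM.exists_norm_le hα₀ hF hX hGA.nonneg hnet.row_stochastic hr hε hx,
    DIKM.exists_isRegularityConst hN hreg, ?_⟩
  intro ϖ ξ w b hw χ _ hχ κ κ₀ hκ _ _
  obtain ⟨xs, hxs, hlim⟩ :=
    DIKM.exists_tendsto_commonFix hN hw hα₀ hF hX hGA hnet hr hε hx hχ hκ
  refine ⟨xs, hxs, hlim, fun hε0 i => ?_⟩
  obtain ⟨C, q, hC, hq0, hq1, hCq⟩ :=
    DIKM.exists_norm_sub_sq_le_geometric hN hw hα₀ hF hX hGA hnet hr hε0 hx hχ hκ hlim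
  have hs0 : 0 < √q := Real.sqrt_pos.2 hq0
  have hs1 : √q < 1 := by rw [Real.sqrt_lt' one_pos]; simpa using hq1
  have hnorm : ∀ i k, ‖x i k - xs‖ ≤ √C * √q ^ k := fun i k => by
    refine le_of_sq_le_sq ?_ (by positivity)
    rw [mul_pow, Real.sq_sqrt hC, ← pow_mul, mul_comm k 2, pow_mul, Real.sq_sqrt hq0.le]
    exact hCq i k
  have hO := DIKM.isBigO_pow_rpow hs0 hs1 (Real.log (1 / ξ))
  refine ⟨.trans (.of_bound √C (.of_forall fun k => ?_)) hO,
    .trans (.of_bound C (.of_forall fun k => ?_))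
      (DIKM.isBigO_pow_rpow hq0 hq1 (Real.log (1 / ξ))),
    .trans (.of_bound (2 * √C) (.of_forall fun k => ?_)) hO⟩
  · rw [norm_norm, Real.norm_of_nonneg (by positivity)]
    exact hnorm i k
  · rw [Real.norm_of_nonneg (by positivity), Real.norm_of_nonneg (by positivity)]
    refine le_trans ?_ (hCq i k)
    rw [← dist_eq_norm]
    exact pow_le_pow_left₀ Metric.infDist_nonneg (Metric.infDist_le_dist_of_mem hxs) 2
  · rw [norm_norm, Real.norm_of_nonneg (by positivity)]
    -- The average is a convex combination of the agents, so it obeys their common bound.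
    have h1 : ‖DIKM.weightedAverage w x k - xs‖ ≤ √C * √q ^ k :=
      DIKM.norm_sum_smul_sub_le (fun j => (hw.pos k j).le) (hw.sum_one k) fun j => hnorm j k
    have h2 := norm_sub_le_norm_sub_add_norm_sub (x i k) xs (DIKM.weightedAverage w x k)
    rw [norm_sub_rev xs] at h2
    linarith [hnorm i k]
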